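/- Let $n\ge 1$ and let $\mathbb R^{n,1}$ be $\mathbb R^{n+1}$ with the Lorentzian inner product $\langle X,Y\rangle=\sum_{i=1}^n x_iy_i-x_{n+1}y_{n+1}$. A spacelike hypersurface is a codimension-one embedded $C^2$ submanifold $\mathcal M\subset\mathbb R^{n,1}$ on which $\langle\cdot,\cdot\rangle$ induces a Riemannian metric. Its principal curvatures at a point are the eigenvalues of the Weingarten map $v\mapsto\bar\nabla_v\nu$ on the tangent space, where $\nu$ is the future-directed timelike unit normal field ($\langle\nu,\nu\rangle=-1$). Let $z(X)=\tfrac12\langle X,X\rangle=\tfrac12\bigl(\sum_{i=1}^n x_i^2-x_{n+1}^2\bigr)$, and let $\nabla z$ be the gradient of $z|_{\mathcal M}$ with respect to the induced metric, with $|\nabla z|^2=\langle\nabla z,\nabla z\rangle$. (1) For every $C_0\in\mathbb R$ there is a constant $C$ depending only on $C_0$ (in particular, not on $n$ or $\mathcal M$) such that the following holds. If $\mathcal M\subset\mathbb R^{n,1}$ is a connected spacelike hypersurface which is closed with respect to the Euclidean topology, contains the origin, and has all principal curvatures bounded by $C_0$ in absolute value at every point, then $$|\nabla z(X)|^2\le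 C\,(z(X)+1)^2\qquad\text{for all }X\in\mathcal M.$$ (2) If $\mathcal M\subset\mathbb R^{n,1}$ is a spacelike hypersurface (not necessarily connected and not necessarily containing the origin) which is closed with respect to the Euclidean topology and has bounded principal curvatures, then $\mathcal M$ is complete with respect to its induced metric; that is, every Cauchy sequence for the induced distance (the infimum of the lengths of $C^1$ curves in $\mathcal M$, equal to $\infty$ if there are none) converges in $\mathcal M$ for that distance. -/

import Mathlib

open Set Filter Topology MeasureTheory
open scoped ENNReal

noncomputable section

/-- The space underlying Minkowski space `ℝ^{n,1}`: points `(x, x_{n+1})` with `x ∈ ℝⁿ`.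
Its topology is the Euclidean one. -/
abbrev Mink (n : ℕ) : Type := EuclideanSpace ℝ (Fin n) × ℝ

namespace Mink

variable {n : ℕ}

/-- The Lorentzian inner product `⟨X, Y⟩ = ∑ᵢ xᵢ yᵢ - x_{n+1} y_{n+1}`. -/
def lorentz (X Y : Mink n) : ℝ := inner ℝ X.1 Y.1 - X.2 * Y.2

/-- The Minkowski distance function from the origin, `z(X) = ⟨X, X⟩ / 2`. -/
def z (X : Mink n) : ℝ := lorentz X X / 2

/-- `M` is an (embedded) `C²` submanifold of codimension one: near each of its points it is the
zero set of a `C²` function without critical points. -/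
def IsHypersurface (M : Set (Mink n)) : Prop :=
  ∀ p ∈ M, ∃ (W : Set (Mink n)) (f : Mink n → ℝ), IsOpen W ∧ p ∈ W ∧
    ContDiffOn ℝ 2 f W ∧ (∀ q ∈ W, fderiv ℝ f q ≠ 0) ∧ M ∩ W = {q ∈ W | f q = 0}

/-- `v` is a tangent vector of `M` at `p`: the velocity at `p` of a curve lying in `M`. -/
def IsTangent (M : Set (Mink n)) (p v : Mink n) : Prop :=
  ∃ γ : ℝ → Mink n, γ 0 = p ∧ (∀ᶠ t in 𝓝 0, γ t ∈ M) ∧ HasDerivAt γ v 0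

/-- A spacelike hypersurface: a `C²` submanifold of codimension one on which the Lorentzian metric
induces a Riemannian (that is, positive definite) metric. -/
def IsSpacelikeHypersurface (M : Set (Mink n)) : Prop :=
  IsHypersurface M ∧ ∀ p ∈ M, ∀ v, IsTangent M p v → v ≠ 0 → 0 < lorentz v v

/-- `N` is the future directed timelike unit normal vector of `M` at `p`. -/
def IsUnitNormal (M : Set (Mink n)) (p N : Mink n) : Prop :=
  (∀ v, IsTangent M p v → lorentz N v = 0) ∧ lorentz N N = -1 ∧ 0 < N.2

/-- `κ` is a principal curvature of `M` at `p`: an eigenvalue, with a nonzero tangent eigenvector,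
of the derivative along `M` of the unit normal field `ν` (the Weingarten map `v ↦ ∇̄_v ν`).
Near `p` on `M` the field `ν` is determined by `M`, and so is `A` on tangent vectors. -/
def IsPrincipalCurvature (M : Set (Mink n)) (p : Mink n) (κ : ℝ) : Prop :=
  ∃ (ν : Mink n → Mink n) (A : Mink n →L[ℝ] Mink n),
    (∀ᶠ q in 𝓝[M] p, IsUnitNormal M q (ν q)) ∧ HasFDerivWithinAt ν A M p ∧
      ∃ v, v ≠ 0 ∧ IsTangent M p v ∧ A v = κ • v

/-- All principal curvatures of `M` are bounded by `C₀` in absolute value. -/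
def PrincipalCurvaturesBoundedBy (M : Set (Mink n)) (C₀ : ℝ) : Prop :=
  ∀ p ∈ M, ∀ κ, IsPrincipalCurvature M p κ → |κ| ≤ C₀

/-- `G` is the gradient `∇f(p)` of `f` restricted to `M`, with respect to the induced metric:
the tangent vector with `⟨G, v⟩ = df_p(v)` for all tangent vectors `v`. -/
def IsInducedGradient (M : Set (Mink n)) (f : Mink n → ℝ) (p G : Mink n) : Prop :=
  IsTangent M p G ∧ ∀ v, IsTangent M p v → lorentz G v = fderiv ℝ f p v

theorem lorentz_comm (X Y : Mink n) : lorentz X Y = lorentz Y X := by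
  simp only [lorentz, real_inner_comm, mul_comm]

/-- The squared norm `|∇f(p)|²` does not depend on which vector is used as the gradient. -/
theorem IsInducedGradient.lorentz_self_eq {M : Set (Mink n)} {f : Mink n → ℝ} {p G G' : Mink n}
    (h : IsInducedGradient M f p G) (h' : IsInducedGradient M f p G') :
    lorentz G G = lorentz G' G' := by
  rw [h.2 G h.1, ← h'.2 G h.1, lorentz_comm, h.2 G' h'.1, ← h'.2 G' h'.1]

/-- The length `∫₀¹ ⟨γ', γ'⟩^{1/2} dt` of a curve for the induced metric. -/
def inducedLength (γ : ℝ → Mink n) : ℝ≥0∞ :=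
  ∫⁻ t in Icc (0 : ℝ) 1, ENNReal.ofReal
    (Real.sqrt (lorentz (derivWithin γ (Icc 0 1) t) (derivWithin γ (Icc 0 1) t)))

/-- The distance of the induced metric on `M`: the infimum of the lengths of the `C¹` curves in `M`
from `p` to `q` (it is `∞` if there are none). -/
def inducedEDist (M : Set (Mink n)) (p q : Mink n) : ℝ≥0∞ :=
  ⨅ (γ : ℝ → Mink n) (_ : ContDiffOn ℝ 1 γ (Icc 0 1) ∧ (∀ t ∈ Icc (0 : ℝ) 1, γ t ∈ M) ∧
    γ 0 = p ∧ γ 1 = q), inducedLength γ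

/-- `M` is complete in its induced metric: every Cauchy sequence for the induced distance
converges for the induced distance to a point of `M`. -/
def IsInducedComplete (M : Set (Mink n)) : Prop :=
  ∀ x : ℕ → Mink n, (∀ k, x k ∈ M) →
    (∀ ε : ℝ≥0∞, 0 < ε → ∃ N, ∀ k ≥ N, ∀ l ≥ N, inducedEDist M (x k) (x l) < ε) →
    ∃ p ∈ M, Tendsto (fun k => inducedEDist M (x k) p) atTop (𝓝 0)

end Mink

end

/-!
Let `a ∈ M`. Since `M` is spacelike, the projection of `M` to `ℝⁿ` is a local homeomorphism, and a
lift to `M` of a segment starting at `a.1` stays in the light cone of `a`. As `M` is closed, the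
part of `M` where the lift can run is compact, so all segments lift; hence `M` contains an
entire spacelike graph through `a`, which is a connected component of `M`.

On that graph put `z = ⟨X - a, X - a⟩ / 2 ≥ 0` and let `S = ⟨X - a, ν⟩` be the support function, so
that `|∇z|² = 2 z + S²` and `∇S = A ∇z` with `A` the Weingarten map. If `|A| ≤ C₀`, then at a point
where `∇z ≠ 0` both `z` and `(C₀ + 1) z ∓ S` strictly increase in the direction `∇z`. The
function `±S - (C₀ + 1) z` therefore has no positive maximum on a sublevel set of `z`. These sets
are compact, so `|S| ≤ (C₀ + 1) z`, which bounds `|∇z|` by a multiple of `z + 1`.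

Consequently `log (z + 1)` is Lipschitz for the induced distance, and balls for that distance lie in
compact sublevel sets of `z`, where the induced and the Euclidean metrics are comparable.
-/

open Metric
open scoped NNReal

theorem exists_curve_in_levelSet {E F : Type*} [NormedAddCommGroup E] [NormedSpace ℝ E]
    [CompleteSpace E] [NormedAddCommGroup F] [NormedSpace ℝ F] [FiniteDimensional ℝ F]
    {f : E → F} {f' : E →L[ℝ] F} {p v : E} (hf : HasStrictFDerivAt f f' p)
    (hf' : f'.range = ⊤) (hv : f' v = 0) :
    ∃ γ : ℝ → E, γ 0 = p ∧ (∀ᶠ t in 𝓝 0, f (γ t) = f p) ∧ HasDerivAt γ v 0 := by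
  let k : f'.ker := ⟨v, hv⟩
  have hline : HasDerivAt (fun t : ℝ => t • k) k 0 := by
    simpa using (hasDerivAt_id (0 : ℝ)).smul_const k
  refine ⟨fun t => hf.implicitFunction f f' hf' (f p) (t • k), by simp, ?_, ?_⟩
  · have hlim : Tendsto (fun t : ℝ => (f p, t • k)) (𝓝 0) (𝓝 (f p, 0)) :=
      tendsto_const_nhds.prodMk_nhds (by simpa using hline.continuousAt.tendsto)
    exact hlim.eventually (hf.map_implicitFunction_eq hf')
  · have hG := (hf.to_implicitFunction hf').hasFDerivAt
    exact HasFDerivAt.comp_hasDerivAt (0 : ℝ) (by simpa using hG) hline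

theorem exists_implicit_graph {E : Type*} [NormedAddCommGroup E] [NormedSpace ℝ E]
    [CompleteSpace E] {k : WithTop ℕ∞} (hk : k ≠ 0) {f : E × ℝ → ℝ} {p : E × ℝ}
    (hf : ContDiffAt ℝ k f p) (hp : fderiv ℝ f p (0, 1) ≠ 0) :
    ∃ u : E → ℝ, ContDiffAt ℝ k u p.1 ∧ ∀ᶠ q in 𝓝 p, f q = f p ↔ u q.1 = q.2 := by
  have hinv : (fderiv ℝ f p ∘L .inr ℝ E ℝ).IsInvertible :=
    ⟨ContinuousLinearEquiv.unitsEquivAut ℝ (Units.mk0 _ hp), by ext; simp⟩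
  exact ⟨hf.implicitFunction hk hinv, hf.contDiffAt_implicitFunction hk hinv,
    hf.eventually_apply_eq_iff_implicitFunction hk hinv⟩

theorem norm_lt_one_of_abs_apply_lt {F : Type*} [NormedAddCommGroup F] [InnerProductSpace ℝ F]
    [CompleteSpace F] {L : F →L[ℝ] ℝ} (h : ∀ v, v ≠ 0 → |L v| < ‖v‖) : ‖L‖ < 1 := by
  obtain ⟨w, rfl⟩ := (InnerProductSpace.toDual ℝ F).surjective L
  rw [LinearIsometryEquiv.norm_map]
  rcases eq_or_ne w 0 with rfl | hw
  · simp
  · have hlt := h w hw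
    rw [InnerProductSpace.toDual_apply_apply, real_inner_self_eq_norm_sq, abs_sq] at hlt
    nlinarith [norm_pos_iff.2 hw]

theorem exists_pos_forall_of_isCompact {X : Type*} [TopologicalSpace X] {P : ℝ → X → Prop}
    (hP : ∀ ⦃r r' x⦄, r ≤ r' → P r' x → P r x) {K : Set X} (hK : IsCompact K)
    (h : ∀ x ∈ K, ∃ r > 0, ∀ᶠ y in 𝓝[K] x, P r y) : ∃ r > 0, ∀ x ∈ K, P r x := by
  refine hK.induction_on (p := fun s => ∃ r > 0, ∀ x ∈ s, P r x) ⟨1, one_pos, by simp⟩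
    (fun s t hst ⟨r, hr, ht⟩ => ⟨r, hr, fun x hx => ht x (hst hx)⟩) ?_ ?_
  · rintro s t ⟨r, hr, hs⟩ ⟨r', hr', ht⟩
    refine ⟨min r r', lt_min hr hr', ?_⟩
    rintro x (hx | hx)
    exacts [hP (min_le_left _ _) (hs x hx), hP (min_le_right _ _) (ht x hx)]
  · intro x hx
    obtain ⟨r, hr, hy⟩ := h x hx
    exact ⟨_, hy, r, hr, fun y hy => hy⟩

theorem isLocalHomeomorph_fst_of_locally_graph {X Y : Type*} [TopologicalSpace X]
    [TopologicalSpace Y] {M : Set (X × Y)}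
    (h : ∀ p ∈ M, ∃ u : X → Y, ContinuousAt u p.1 ∧ ∀ᶠ q in 𝓝 p, q ∈ M ↔ u q.1 = q.2) :
    IsLocalHomeomorph fun q : M => q.1.1 := by
  have hcont : Continuous fun q : M => q.1.1 := by fun_prop
  have hopen : IsOpenMap fun q : M => q.1.1 := by
    rw [isOpenMap_iff_nhds_le]
    rintro ⟨p, hp⟩ s hs
    obtain ⟨u, hu, hq⟩ := h p hp
    have hup : u p.1 = p.2 := hq.self_of_nhds.1 hp
    obtain ⟨t, ht, hts⟩ := mem_nhds_subtype _ _ _ |>.1 (mem_map.1 hs)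
    have hlim : Tendsto (fun x => (x, u x)) (𝓝 p.1) (𝓝 p) := by
      simpa [hup] using (continuousAt_id.prodMk hu).tendsto
    filter_upwards [hlim.eventually hq, hlim ht] with x hxM hxt
    exact @hts ⟨(x, u x), hxM.2 rfl⟩ hxt
  rw [isLocalHomeomorph_iff_isOpenEmbedding_restrict]
  rintro ⟨p, hp⟩
  obtain ⟨u, -, hq⟩ := h p hp
  obtain ⟨V, hV, hVo, hpV⟩ := eventually_nhds_iff.1 hq
  have hVM : IsOpen ((↑) ⁻¹' V : Set M) := hVo.preimage continuous_subtype_val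
  refine ⟨_, hVM.mem_nhds hpV, .of_continuous_injective_isOpenMap
    (hcont.comp continuous_subtype_val) ?_ (hopen.comp hVM.isOpenMap_subtype_val)⟩
  rintro ⟨⟨q, hqM⟩, hqV⟩ ⟨⟨q', hqM'⟩, hqV'⟩ (hqq' : q.1 = q'.1)
  have hsnd : q.2 = q'.2 := by rw [← (hV q hqV).1 hqM, ← (hV q' hqV').1 hqM', hqq']
  exact Subtype.ext (Subtype.ext (Prod.ext hqq' hsnd))

theorem exists_pos_abs_sub_le_norm_sub {F : Type*} [NormedAddCommGroup F] [NormedSpace ℝ F]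
    [ProperSpace F] {u : F → ℝ} (hu : ∀ x y, x ≠ y → |u x - u y| < ‖x - y‖) (a : F) :
    ∃ δ > 0, ∀ x, 1 ≤ ‖x - a‖ → |u x - u a| ≤ ‖x - a‖ - δ := by
  have hle : ∀ x y, |u x - u y| ≤ ‖x - y‖ := fun x y => by
    rcases eq_or_ne x y with rfl | hxy
    exacts [by simp, (hu x y hxy).le]
  have hcont : Continuous u := (LipschitzWith.of_dist_le_mul (K := 1) fun x y => by
    simpa [Real.dist_eq, dist_eq_norm] using hle x y).continuous
  obtain ⟨δ, hδ, hsphere⟩ : ∃ δ > 0, ∀ y ∈ sphere a 1, |u y - u a| ≤ 1 - δ := by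
    rcases (sphere a 1).eq_empty_or_nonempty with hempty | hne
    · exact ⟨1, one_pos, by simp [hempty]⟩
    · obtain ⟨y, hy, hmax⟩ := (isCompact_sphere a 1).exists_isMaxOn hne
        (f := fun y => |u y - u a|) (by fun_prop)
      have hlt := hu y a (ne_of_mem_sphere hy one_ne_zero)
      rw [mem_sphere_iff_norm.1 hy] at hlt
      exact ⟨1 - |u y - u a|, sub_pos.2 hlt, fun w hw => by simpa using hmax hw⟩
  refine ⟨δ, hδ, fun x hx => ?_⟩
  have hR : 0 < ‖x - a‖ := one_pos.trans_le hx
  have hy : a + ‖x - a‖⁻¹ • (x - a) ∈ sphere a 1 := by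
    simp [norm_smul, hR.ne']
  have hxy : x - (a + ‖x - a‖⁻¹ • (x - a)) = (1 - ‖x - a‖⁻¹) • (x - a) := by
    module
  calc |u x - u a|
    _ ≤ |u x - u (a + ‖x - a‖⁻¹ • (x - a))| + |u (a + ‖x - a‖⁻¹ • (x - a)) - u a| :=
      abs_sub_le _ _ _
    _ ≤ ‖x - (a + ‖x - a‖⁻¹ • (x - a))‖ + (1 - δ) := add_le_add (hle _ _) (hsphere _ hy)
    _ = ‖x - a‖ - δ := by
      rw [hxy, norm_smul, Real.norm_of_nonneg (sub_nonneg.2 (inv_le_one_of_one_le₀ hx)), sub_mul,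
        inv_mul_cancel₀ hR.ne']
      ring

theorem abs_sub_lt_norm_sub_of_norm_fderiv_lt_one {F : Type*} [NormedAddCommGroup F]
    [NormedSpace ℝ F] {u : F → ℝ} (hu : Differentiable ℝ u) (h : ∀ x, ‖fderiv ℝ u x‖ < 1)
    {x y : F} (hxy : x ≠ y) : |u x - u y| < ‖x - y‖ := by
  obtain ⟨c, -, hc⟩ := domain_mvt (f := u) (s := univ) (x := y) (y := x)
    (fun x _ => (hu x).hasFDerivAt.hasFDerivWithinAt) convex_univ (mem_univ _) (mem_univ _)
  rw [hc, ← Real.norm_eq_abs]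
  exact ((fderiv ℝ u c).le_opNorm _).trans_lt
    (mul_lt_of_lt_one_left (norm_pos_iff.2 (sub_ne_zero.2 hxy)) (h c))

theorem mem_posTangentConeAt_sublevel {E : Type*} [NormedAddCommGroup E] [NormedSpace ℝ E]
    {z : E → ℝ} {z' : E →L[ℝ] ℝ} {x v : E} {c : ℝ} (hz : HasFDerivAt z z' x) (hx : z x ≤ c)
    (hv : z' v < 0) : v ∈ posTangentConeAt {y | z y ≤ c} x := by
  refine mem_posTangentConeAt_of_frequently_mem (Eventually.frequently ?_)
  have hline : HasDerivAt (fun t : ℝ => z (x + t • v)) (z' v) 0 :=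
    hz.hasLineDerivAt v
  have hslope := (hasDerivAt_iff_tendsto_slope.1 hline).eventually (gt_mem_nhds hv)
  filter_upwards [nhdsWithin_mono 0 (fun t (ht : 0 < t) => ht.ne') hslope, self_mem_nhdsWithin]
    with t ht (htpos : 0 < t)
  have hlt : z (x + t • v) < z x := by
    rwa [slope_def_field, sub_zero, div_lt_iff₀ htpos, zero_mul, zero_smul, add_zero,
      sub_neg] at ht
  exact hlt.le.trans hx

theorem nonpos_of_isCompact_sublevel {E : Type*} [NormedAddCommGroup E] [NormedSpace ℝ E]
    {z f : E → ℝ} (hz : Differentiable ℝ z) (hf : Differentiable ℝ f)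
    (hK : ∀ c, IsCompact {x | z x ≤ c})
    (h : ∀ x, 0 < f x → ∃ v, fderiv ℝ z x v < 0 ∧ 0 < fderiv ℝ f x v) (x : E) : f x ≤ 0 := by
  obtain ⟨y, hy, hmax⟩ := (hK (z x)).exists_isMaxOn ⟨x, le_refl (z x)⟩ hf.continuous.continuousOn
  refine (hmax (le_refl (z x))).trans (not_lt.1 fun hpos => ?_)
  obtain ⟨v, hzv, hfv⟩ := h y hpos
  exact hfv.not_ge (hmax.localize.hasFDerivWithinAt_nonpos (hf y).hasFDerivAt.hasFDerivWithinAt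
    (mem_posTangentConeAt_sublevel (hz y).hasFDerivAt hy hzv))

section BilinearForms

variable {F : Type*} [NormedAddCommGroup F] [NormedSpace ℝ F]

theorem sq_apply_le_of_symm (g : F →L[ℝ] F →L[ℝ] ℝ) (hsymm : ∀ v w, g v w = g w v)
    (hnonneg : ∀ v, 0 ≤ g v v) (v w : F) : g v w ^ 2 ≤ g v v * g w w :=
  LinearMap.BilinForm.apply_sq_le_of_symm g.toLinearMap₁₂ hnonneg ⟨hsymm⟩ v w

theorem exists_eigenvector_apply_self_le [FiniteDimensional ℝ F] [Nontrivial F]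
    {g h : F →L[ℝ] F →L[ℝ] ℝ} (hg : ∀ v w, g v w = g w v) (hpos : ∀ v, v ≠ 0 → 0 < g v v)
    (hh : ∀ v w, h v w = h w v) :
    ∃ κ : ℝ, ∃ v, v ≠ 0 ∧ h v = κ • g v ∧ ∀ w, h w w ≤ κ * g w w := by
  have := FiniteDimensional.proper_real F
  have hne : ∀ w ∈ sphere (0 : F) 1, w ≠ 0 := fun w hw => ne_of_mem_sphere hw one_ne_zero
  obtain ⟨v, hv, hmax⟩ := (isCompact_sphere (0 : F) 1).exists_isMaxOn
    (NormedSpace.sphere_nonempty.2 zero_le_one) (f := fun w => h w w / g w w)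
    (ContinuousOn.div (by fun_prop) (by fun_prop) fun w hw => (hpos w (hne w hw)).ne')
  set κ := h v v / g v v with hκ
  have hle : ∀ w, h w w ≤ κ * g w w := fun w => by
    rcases eq_or_ne w 0 with rfl | hw
    · simp
    · have hnorm : ‖w‖⁻¹ ≠ 0 := inv_ne_zero (norm_ne_zero_iff.2 hw)
      have hquot : h (‖w‖⁻¹ • w) (‖w‖⁻¹ • w) / g (‖w‖⁻¹ • w) (‖w‖⁻¹ • w) ≤ κ :=
        hmax (show ‖w‖⁻¹ • w ∈ sphere (0 : F) 1 by simp [norm_smul, norm_ne_zero_iff.2 hw])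
      simp only [map_smul, _root_.smul_apply, smul_eq_mul] at hquot
      rwa [mul_div_mul_left _ _ hnorm, mul_div_mul_left _ _ hnorm,
        div_le_iff₀ (hpos w hw)] at hquot
  refine ⟨κ, v, hne v hv, ?_, hle⟩
  ext w
  have hCS := sq_apply_le_of_symm (κ • g - h) (fun v w => by simp [hg v w, hh v w])
    (fun v => by simpa using hle v) v w
  have hzero : κ * g v v - h v v = 0 := by
    rw [hκ, div_mul_cancel₀ _ (hpos v (hne v hv)).ne', sub_self]
  simp only [_root_.sub_apply, _root_.smul_apply, smul_eq_mul, hzero, zero_mul] at hCS ⊢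
  linarith [pow_eq_zero_iff two_ne_zero |>.1 (le_antisymm hCS (sq_nonneg _))]

theorem abs_apply_self_le_of_forall_eigenvector [FiniteDimensional ℝ F]
    {g h : F →L[ℝ] F →L[ℝ] ℝ} (hg : ∀ v w, g v w = g w v) (hpos : ∀ v, v ≠ 0 → 0 < g v v)
    (hh : ∀ v w, h v w = h w v) {C : ℝ} (hC : ∀ κ : ℝ, ∀ v, v ≠ 0 → h v = κ • g v → |κ| ≤ C)
    (v : F) : |h v v| ≤ C * g v v := by
  rcases eq_or_ne v 0 with rfl | hv
  · simp
  have : Nontrivial F := ⟨v, 0, hv⟩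
  refine abs_le'.2 ⟨?_, ?_⟩
  · obtain ⟨κ, v₀, hv₀, hκ, hle⟩ := exists_eigenvector_apply_self_le hg hpos hh
    exact (hle v).trans (mul_le_mul_of_nonneg_right
      ((le_abs_self κ).trans (hC κ v₀ hv₀ hκ)) (hpos v hv).le)
  · obtain ⟨κ, v₀, hv₀, hκ, hle⟩ := exists_eigenvector_apply_self_le (h := -h) hg hpos
      (fun v w => by simp [hh v w])
    have hκ' : h v₀ = (-κ) • g v₀ := by
      ext w
      simpa using neg_eq_iff_eq_neg.1 (DFunLike.congr_fun hκ w)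
    have hκC := hC (-κ) v₀ hv₀ hκ'
    rw [abs_neg] at hκC
    exact (hle v).trans (mul_le_mul_of_nonneg_right ((le_abs_self κ).trans hκC) (hpos v hv).le)

end BilinearForms

theorem differentiableAt_gradient {F : Type*} [NormedAddCommGroup F] [InnerProductSpace ℝ F]
    [CompleteSpace F] {f : F → ℝ} {x : F} (hf : DifferentiableAt ℝ (fderiv ℝ f) x) :
    DifferentiableAt ℝ (gradient f) x := by
  have hlin : IsBoundedLinearMap ℝ (InnerProductSpace.toDual ℝ F).symm :=
    IsLinearMap.with_bound ⟨map_add _, fun c ℓ => by simp⟩ 1 fun ℓ => by simp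
  exact hlin.differentiableAt.comp x hf

theorem enorm_sub_le_lintegral_derivWithin_of_mem_Icc {F : Type*} [NormedAddCommGroup F]
    [NormedSpace ℝ F] {f : ℝ → F} {a b t : ℝ} (hf : ContDiffOn ℝ 1 f (Icc a b))
    (ht : t ∈ Icc a b) : ‖f t - f a‖ₑ ≤ ∫⁻ r in Icc a b, ‖derivWithin f (Icc a b) r‖ₑ := by
  refine (enorm_sub_le_lintegral_deriv_of_contDiffOn_Icc
    (hf.mono (Icc_subset_Icc_right ht.2)) ht.1).trans
    ((lintegral_mono_set (Icc_subset_Icc_right ht.2)).trans_eq ?_)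
  rw [← restrict_Ioo_eq_restrict_Icc]
  exact setLIntegral_congr_fun measurableSet_Ioo fun r hr => by
    rw [derivWithin_of_mem_nhds (Icc_mem_nhds hr.1 hr.2)]

/-! ### The entire graph through a point -/

namespace Mink

variable {n : ℕ} {M : Set (Mink n)}

theorem IsHypersurface.exists_definingFunction (hM : IsHypersurface M) {p : Mink n} (hp : p ∈ M) :
    ∃ f : Mink n → ℝ, ContDiffAt ℝ 2 f p ∧ fderiv ℝ f p ≠ 0 ∧
      ∀ᶠ q in 𝓝 p, q ∈ M ↔ f q = f p := by
  obtain ⟨W, f, hW, hpW, hf, hne, hMW⟩ := hM p hp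
  have hiff : ∀ q ∈ W, q ∈ M ↔ f q = 0 := fun q hq => by
    simpa [hq] using Set.ext_iff.1 hMW q
  refine ⟨f, hf.contDiffAt (hW.mem_nhds hpW), hne p hpW, ?_⟩
  filter_upwards [hW.mem_nhds hpW] with q hq
  rw [hiff q hq, (hiff p hpW).1 hp]

theorem isTangent_of_fderiv_eq_zero {f : Mink n → ℝ} {p v : Mink n} (hf : ContDiffAt ℝ 1 f p)
    (hne : fderiv ℝ f p ≠ 0) (hMf : ∀ᶠ q in 𝓝 p, f q = f p → q ∈ M) (hv : fderiv ℝ f p v = 0) :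
    IsTangent M p v := by
  have hrange : (fderiv ℝ f p).range = ⊤ :=
    LinearMap.range_eq_top.2 (LinearMap.surjective (f := (fderiv ℝ f p).toLinearMap)
      fun h => hne (ContinuousLinearMap.coe_injective h))
  obtain ⟨γ, rfl, hγf, hγ⟩ :=
    exists_curve_in_levelSet (hf.hasStrictFDerivAt one_ne_zero) hrange hv
  refine ⟨γ, rfl, ?_, hγ⟩
  filter_upwards [hγf, hγ.continuousAt.tendsto.eventually hMf] with t ht htM using htM ht

theorem isTangent_graph {u : EuclideanSpace ℝ (Fin n) → ℝ} {x : EuclideanSpace ℝ (Fin n)}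
    (hM : ∀ᶠ y in 𝓝 x, (y, u y) ∈ M) (hu : DifferentiableAt ℝ u x)
    (v : EuclideanSpace ℝ (Fin n)) : IsTangent M (x, u x) (v, fderiv ℝ u x v) := by
  have hline : HasDerivAt (fun t : ℝ => x + t • v) v 0 := by
    simpa using ((hasDerivAt_id (0 : ℝ)).smul_const v).const_add x
  have hlim : Tendsto (fun t : ℝ => x + t • v) (𝓝 0) (𝓝 x) := by
    simpa using hline.continuousAt.tendsto
  exact ⟨fun t => (x + t • v, u (x + t • v)), by simp, hlim.eventually hM,
    hline.prodMk (HasFDerivAt.comp_hasDerivAt (0 : ℝ) (by simpa using hu.hasFDerivAt) hline)⟩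

namespace IsSpacelikeHypersurface

theorem norm_fderiv_lt_one (hM : IsSpacelikeHypersurface M) {u : EuclideanSpace ℝ (Fin n) → ℝ}
    {x : EuclideanSpace ℝ (Fin n)} (huM : ∀ᶠ y in 𝓝 x, (y, u y) ∈ M)
    (hu : DifferentiableAt ℝ u x) : ‖fderiv ℝ u x‖ < 1 := by
  refine norm_lt_one_of_abs_apply_lt fun v hv => abs_lt_of_sq_lt_sq ?_ (norm_nonneg v)
  have hpos := hM.2 _ huM.self_of_nhds _ (isTangent_graph huM hu v) (by simp [hv])
  simp only [lorentz, real_inner_self_eq_norm_sq] at hpos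
  linarith [sq (fderiv ℝ u x v)]

theorem exists_local_graph (hM : IsSpacelikeHypersurface M) {p : Mink n} (hp : p ∈ M) :
    ∃ u : EuclideanSpace ℝ (Fin n) → ℝ, ContDiffAt ℝ 2 u p.1 ∧
      ∀ᶠ q in 𝓝 p, q ∈ M ↔ u q.1 = q.2 := by
  obtain ⟨f, hf, hne, hMf⟩ := hM.1.exists_definingFunction hp
  have hvert : fderiv ℝ f p (0, 1) ≠ 0 := fun h0 => by
    have htan : IsTangent M p (0, 1) :=
      isTangent_of_fderiv_eq_zero (hf.of_le one_le_two) hne (hMf.mono fun _ => Iff.mpr) h0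
    have hpos := hM.2 p hp _ htan (by simp)
    norm_num [lorentz] at hpos
  obtain ⟨u, hu, hfu⟩ := exists_implicit_graph two_ne_zero hf hvert
  exact ⟨u, hu, by filter_upwards [hMf, hfu] with q hqM hqu using hqM.trans hqu⟩

theorem exists_lipschitz_graph (hM : IsSpacelikeHypersurface M) {p : Mink n} (hp : p ∈ M) :
    ∃ u : EuclideanSpace ℝ (Fin n) → ℝ, ∃ r > 0, LipschitzOnWith 1 u (ball p.1 r) ∧
      (∀ x ∈ ball p.1 r, (x, u x) ∈ M) ∧ ∀ᶠ q in 𝓝[M] p, u q.1 = q.2 := by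
  obtain ⟨u, hu, hMu⟩ := hM.exists_local_graph hp
  have hup : u p.1 = p.2 := hMu.self_of_nhds.1 hp
  have hlim : Tendsto (fun x => (x, u x)) (𝓝 p.1) (𝓝 p) := by
    simpa [hup] using (continuousAt_id.prodMk hu.continuousAt).tendsto
  have hmem : ∀ᶠ x in 𝓝 p.1, (x, u x) ∈ M := (hlim.eventually hMu).mono fun x hx => hx.2 rfl
  obtain ⟨r, hr, hball⟩ := eventually_nhds_iff_ball.1 (hmem.and (hu.eventually (by norm_num)))
  have hdiff : ∀ x ∈ ball p.1 r, DifferentiableAt ℝ u x := fun x hx =>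
    (hball x hx).2.differentiableAt two_ne_zero
  refine ⟨u, r, hr, (convex_ball p.1 r).lipschitzOnWith_of_nnnorm_fderiv_le hdiff fun x hx => ?_,
    fun x hx => (hball x hx).1, ?_⟩
  · have hxM : ∀ᶠ y in 𝓝 x, (y, u y) ∈ M :=
      eventually_of_mem (isOpen_ball.mem_nhds hx) fun y hy => (hball y hy).1
    exact (hM.norm_fderiv_lt_one hxM (hdiff x hx)).le
  · filter_upwards [nhdsWithin_le_nhds hMu, self_mem_nhdsWithin] with q hq hqM using hq.1 hqM

theorem exists_uniform_radius (hM : IsSpacelikeHypersurface M) {K : Set (Mink n)}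
    (hK : IsCompact K) (hKM : K ⊆ M) :
    ∃ r > 0, ∀ q ∈ K, ∃ u : EuclideanSpace ℝ (Fin n) → ℝ, u q.1 = q.2 ∧
      LipschitzOnWith 1 u (ball q.1 r) ∧ ∀ x ∈ ball q.1 r, (x, u x) ∈ M := by
  refine exists_pos_forall_of_isCompact ?_ hK fun p hp => ?_
  · rintro r r' q hr ⟨u, hq, hu, hmem⟩
    have hsub : ball q.1 r ⊆ ball q.1 r' := ball_subset_ball hr
    exact ⟨u, hq, hu.mono hsub, fun x hx => hmem x (hsub hx)⟩
  · obtain ⟨u, r, hr, hu, hmem, hq⟩ := hM.exists_lipschitz_graph (hKM hp)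
    have hnear : ∀ᶠ q : Mink n in 𝓝[K] p, dist q.1 p.1 < r / 2 :=
      nhdsWithin_le_nhds
        (continuous_fst.continuousAt.preimage_mem_nhds (ball_mem_nhds p.1 (half_pos hr)))
    refine ⟨r / 2, half_pos hr, ?_⟩
    filter_upwards [hnear, nhdsWithin_mono p hKM hq] with q hqp hqu
    have hsub : ball q.1 (r / 2) ⊆ ball p.1 r := ball_subset_ball' (by linarith)
    exact ⟨u, hqu, hu.mono hsub, fun x hx => hmem x (hsub hx)⟩

end IsSpacelikeHypersurface

/-- `h` lifts the segment `t ↦ a + t v`, `0 ≤ t ≤ s`, of the base `ℝⁿ` to a curve in `M` that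
starts at `a` and is nowhere steeper than the light cone of `a`. -/
structure IsSegmentLift (M : Set (Mink n)) (a : Mink n) (v : EuclideanSpace ℝ (Fin n)) (s : ℝ)
    (h : ℝ → ℝ) : Prop where
  continuousOn : ContinuousOn h (Icc 0 s)
  mem : ∀ t ∈ Icc 0 s, (a.1 + t • v, h t) ∈ M
  abs_sub_snd_le : ∀ t ∈ Icc 0 s, |h t - a.2| ≤ t * ‖v‖

namespace IsSegmentLift

variable {a : Mink n} {v : EuclideanSpace ℝ (Fin n)} {s s' r δ : ℝ} {h : ℝ → ℝ}
  {u : EuclideanSpace ℝ (Fin n) → ℝ}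

theorem mono (H : IsSegmentLift M a v s h) (hs : s' ≤ s) : IsSegmentLift M a v s' h :=
  have hsub : Icc 0 s' ⊆ Icc 0 s := Icc_subset_Icc_right hs
  ⟨H.continuousOn.mono hsub, fun t ht => H.mem t (hsub ht),
    fun t ht => H.abs_sub_snd_le t (hsub ht)⟩

theorem zero (ha : a ∈ M) : IsSegmentLift M a v 0 fun _ => a.2 where
  continuousOn := continuousOn_const
  mem t ht := by simpa [le_antisymm ht.2 ht.1] using ha
  abs_sub_snd_le t ht := by simpa using mul_nonneg ht.1 (norm_nonneg v)

theorem extend (H : IsSegmentLift M a v s h) (hs : 0 ≤ s) (hδ : 0 ≤ δ) (hδr : ‖v‖ * δ < r)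
    (hu : LipschitzOnWith 1 u (ball (a.1 + s • v) r)) (hus : u (a.1 + s • v) = h s)
    (hmem : ∀ x ∈ ball (a.1 + s • v) r, (x, u x) ∈ M) :
    IsSegmentLift M a v (s + δ) fun t => if t ≤ s then h t else u (a.1 + t • v) := by
  have hdist : ∀ t, s ≤ t → dist (a.1 + t • v) (a.1 + s • v) = (t - s) * ‖v‖ := fun t ht => by
    rw [dist_add_left, dist_eq_norm, ← sub_smul, norm_smul, Real.norm_of_nonneg (sub_nonneg.2 ht)]
  have hball : ∀ t ∈ Icc s (s + δ), a.1 + t • v ∈ ball (a.1 + s • v) r := fun t ht => by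
    rw [mem_ball, hdist t ht.1]
    nlinarith [ht.2, norm_nonneg v]
  have hcenter : a.1 + s • v ∈ ball (a.1 + s • v) r := hball s ⟨le_rfl, by linarith⟩
  refine ⟨?_, fun t ht => ?_, fun t ht => ?_⟩
  · rw [← Icc_union_Icc_eq_Icc hs (le_add_of_nonneg_right hδ)]
    refine (H.continuousOn.congr fun t ht => if_pos ht.2).union_of_isClosed
      ((hu.continuousOn.comp (by fun_prop) hball).congr fun t ht => ?_) isClosed_Icc isClosed_Icc
    rcases ht.1.eq_or_lt with rfl | hlt
    · simp [hus]
    · simp [hlt.not_ge]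
  · split_ifs with hts
    exacts [H.mem t ⟨ht.1, hts⟩, hmem _ (hball t ⟨(not_le.1 hts).le, ht.2⟩)]
  · split_ifs with hts
    · exact H.abs_sub_snd_le t ⟨ht.1, hts⟩
    · have hst : s ≤ t := (not_le.1 hts).le
      have hlip := hu.dist_le_mul _ (hball t ⟨hst, ht.2⟩) _ hcenter
      rw [hdist t hst, hus, Real.dist_eq, NNReal.coe_one, one_mul] at hlip
      calc |u (a.1 + t • v) - a.2|
        _ ≤ |u (a.1 + t • v) - h s| + |h s - a.2| := abs_sub_le _ _ _
        _ ≤ (t - s) * ‖v‖ + s * ‖v‖ := add_le_add hlip (H.abs_sub_snd_le s ⟨hs, le_rfl⟩)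
        _ = t * ‖v‖ := by ring

end IsSegmentLift

namespace IsSpacelikeHypersurface

theorem exists_segmentLift_extend (hM : IsSpacelikeHypersurface M) (hMc : IsClosed M)
    (a : Mink n) (v : EuclideanSpace ℝ (Fin n)) :
    ∃ δ > 0, ∀ s ∈ Icc (0 : ℝ) 1, ∀ h, IsSegmentLift M a v s h →
      ∃ h', IsSegmentLift M a v (s + δ) h' := by
  have hK : IsCompact ((closedBall a.1 ‖v‖ ×ˢ closedBall a.2 ‖v‖) ∩ M) :=
    ((isCompact_closedBall _ _).prod (isCompact_closedBall _ _)).inter_right hMc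
  obtain ⟨r, hr, hloc⟩ := hM.exists_uniform_radius hK inter_subset_right
  obtain ⟨δ, hδ, hδr⟩ := exists_pos_mul_lt hr ‖v‖
  refine ⟨δ, hδ, fun s hs h H => ?_⟩
  have hsmem : s ∈ Icc 0 s := ⟨hs.1, le_rfl⟩
  have hsv : s * ‖v‖ ≤ ‖v‖ := mul_le_of_le_one_left (norm_nonneg v) hs.2
  obtain ⟨u, hus, hu, hmem⟩ := hloc (a.1 + s • v, h s)
    ⟨⟨by simpa [norm_smul, abs_of_nonneg hs.1] using hsv,
      by simpa [Real.dist_eq] using (H.abs_sub_snd_le s hsmem).trans hsv⟩, H.mem s hsmem⟩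
  exact ⟨_, H.extend hs.1 hδ.le hδr hu hus hmem⟩

theorem exists_segmentLift (hM : IsSpacelikeHypersurface M) (hMc : IsClosed M) {a : Mink n}
    (ha : a ∈ M) (v : EuclideanSpace ℝ (Fin n)) : ∃ h, IsSegmentLift M a v 1 h := by
  obtain ⟨δ, hδ, hext⟩ := hM.exists_segmentLift_extend hMc a v
  have hlift : ∀ k : ℕ, ∃ h, IsSegmentLift M a v (min 1 (k * δ)) h := fun k => by
    induction k with
    | zero => exact ⟨_, by simpa using IsSegmentLift.zero ha⟩
    | succ k ih =>
      obtain ⟨h, H⟩ := ih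
      obtain ⟨h', H'⟩ := hext _ ⟨by positivity, min_le_left _ _⟩ h H
      refine ⟨h', H'.mono ?_⟩
      rw [← min_add_add_right]
      exact min_le_min (by linarith) (by push_cast; linarith)
  obtain ⟨k, hk⟩ := exists_nat_ge (1 / δ)
  obtain ⟨h, H⟩ := hlift k
  exact ⟨h, H.mono (le_min le_rfl ((div_le_iff₀ hδ).1 hk))⟩

theorem isLocalHomeomorph_fst (hM : IsSpacelikeHypersurface M) :
    IsLocalHomeomorph fun q : M => q.1.1 :=
  isLocalHomeomorph_fst_of_locally_graph fun _ hp =>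
    let ⟨u, hu, hMu⟩ := hM.exists_local_graph hp
    ⟨u, hu.continuousAt, hMu⟩

theorem exists_continuous_graph (hM : IsSpacelikeHypersurface M) (hMc : IsClosed M) {a : Mink n}
    (ha : a ∈ M) :
    ∃ u : EuclideanSpace ℝ (Fin n) → ℝ, Continuous u ∧ u a.1 = a.2 ∧ ∀ x, (x, u x) ∈ M := by
  choose h H using fun x => hM.exists_segmentLift hMc ha (x - a.1)
  have h0 : ∀ x, h x 0 = a.2 := fun x => by
    simpa [sub_eq_zero] using (H x).abs_sub_snd_le 0 (left_mem_Icc.2 zero_le_one)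
  have h1 : (1 : ℝ) ∈ Icc (0 : ℝ) 1 := right_mem_Icc.2 zero_le_one
  let f : C(unitInterval × EuclideanSpace ℝ (Fin n), EuclideanSpace ℝ (Fin n)) :=
    ⟨fun q => a.1 + (q.1 : ℝ) • (q.2 - a.1), by fun_prop⟩
  let g : unitInterval × EuclideanSpace ℝ (Fin n) → M := fun q =>
    ⟨(f q, h q.2 q.1), (H q.2).mem q.1 q.1.2⟩
  -- A family of path lifts through a local homeomorphism is continuous if its initial points are.
  have hg : Continuous g := by
    refine hM.isLocalHomeomorph_fst.continuous_lift (T2Space.isSeparatedMap _) f rfl ?_ fun x => ?_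
    · have hg0 : (fun x => g (0, x)) = fun _ => ⟨a, ha⟩ := by
        ext1 x
        exact Subtype.ext (Prod.ext (by simp [g, f]) (by simp [g, h0]))
      exact hg0 ▸ continuous_const
    · exact ((by fun_prop : Continuous fun t : unitInterval => f (t, x)).prodMk
        (continuousOn_iff_continuous_domRestrict.1 (H x).continuousOn)).subtype_mk _
  refine ⟨fun x => (g (1, x)).1.2, by fun_prop, ?_, fun x => ?_⟩
  · simpa [g, sub_eq_zero] using (H a.1).abs_sub_snd_le 1 h1
  · simpa [g] using (H x).mem 1 h1

end IsSpacelikeHypersurface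

/-- The graph of `u` is a spacelike entire graph, and a relatively open subset of `M`. -/
structure IsEntireGraphIn (u : EuclideanSpace ℝ (Fin n) → ℝ) (M : Set (Mink n)) : Prop where
  contDiff : ContDiff ℝ 2 u
  norm_fderiv_lt_one : ∀ x, ‖fderiv ℝ u x‖ < 1
  mem : ∀ x, (x, u x) ∈ M
  eventually_eq : ∀ x, ∀ᶠ q in 𝓝[M] (x, u x), q.2 = u q.1

theorem IsSpacelikeHypersurface.isEntireGraphIn (hM : IsSpacelikeHypersurface M)
    {u : EuclideanSpace ℝ (Fin n) → ℝ} (hu : Continuous u) (hmem : ∀ x, (x, u x) ∈ M) :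
    IsEntireGraphIn u M := by
  have hlocal : ∀ x, ContDiffAt ℝ 2 u x ∧ ∀ᶠ q in 𝓝[M] (x, u x), q.2 = u q.1 := fun x => by
    obtain ⟨w, hw, hMw⟩ := hM.exists_local_graph (hmem x)
    have hlim : Tendsto (fun y => (y, u y)) (𝓝 x) (𝓝 (x, u x)) :=
      (continuous_id.prodMk hu).continuousAt.tendsto
    have huw : u =ᶠ[𝓝 x] w := (hlim.eventually hMw).mono fun y hy => (hy.1 (hmem y)).symm
    have hfst : Tendsto (fun q : Mink n => q.1) (𝓝[M] (x, u x)) (𝓝 x) :=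
      (continuous_fst.tendsto (x, u x)).mono_left nhdsWithin_le_nhds
    refine ⟨hw.congr_of_eventuallyEq huw, ?_⟩
    filter_upwards [hfst.eventually huw, self_mem_nhdsWithin, nhdsWithin_le_nhds hMw]
      with q hq hqM hqw
    rw [hq, hqw.1 hqM]
  exact ⟨contDiff_iff_contDiffAt.2 fun x => (hlocal x).1, fun x => hM.norm_fderiv_lt_one
    (.of_forall hmem) ((hlocal x).1.differentiableAt two_ne_zero), hmem, fun x => (hlocal x).2⟩

theorem IsSpacelikeHypersurface.exists_isEntireGraphIn (hM : IsSpacelikeHypersurface M)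
    (hMc : IsClosed M) {a : Mink n} (ha : a ∈ M) :
    ∃ u : EuclideanSpace ℝ (Fin n) → ℝ, u a.1 = a.2 ∧ IsEntireGraphIn u M :=
  let ⟨u, hu, hua, hmem⟩ := hM.exists_continuous_graph hMc ha
  ⟨u, hua, hM.isEntireGraphIn hu hmem⟩

namespace IsEntireGraphIn

variable {u : EuclideanSpace ℝ (Fin n) → ℝ}

theorem isClopen_graph (hu : IsEntireGraphIn u M) : IsClopen {q : M | q.1.2 = u q.1.1} := by
  have hcont : Continuous fun q : M => u q.1.1 :=
    hu.contDiff.continuous.comp (continuous_fst.comp continuous_subtype_val)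
  refine ⟨isClosed_eq (by fun_prop) hcont, isOpen_iff_mem_nhds.2 ?_⟩
  rintro ⟨⟨x, y⟩, hq⟩ (rfl : y = u x)
  rw [nhds_subtype_eq_comap_nhdsWithin]
  exact (hu.eventually_eq x).comap _

theorem snd_eq_of_isPreconnected (hu : IsEntireGraphIn u M) {T : Set (Mink n)}
    (hT : IsPreconnected T) (hTM : T ⊆ M) {a : Mink n} (haT : a ∈ T) (ha : a.2 = u a.1)
    {q : Mink n} (hq : q ∈ T) : q.2 = u q.1 := by
  have hT' : IsPreconnected ((↑) ⁻¹' T : Set M) := by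
    rwa [← IsInducing.subtypeVal.isPreconnected_image, Subtype.image_preimage_coe,
      inter_eq_right.2 hTM]
  exact hT'.subset_isClopen hu.isClopen_graph ⟨⟨a, hTM haT⟩, haT, ha⟩
    (show (⟨q, hTM hq⟩ : M) ∈ _ from hq)

end IsEntireGraphIn

/-! ### The gradient estimate on an entire graph -/

/-- The Lorentzian inner product as a continuous bilinear form. -/
noncomputable def lorentzL : Mink n →L[ℝ] Mink n →L[ℝ] ℝ :=
  (innerSL ℝ).bilinearComp (.fst ℝ _ ℝ) (.fst ℝ _ ℝ) -
    (ContinuousLinearMap.mul ℝ ℝ).bilinearComp (.snd ℝ _ ℝ) (.snd ℝ _ ℝ)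

@[simp]
theorem lorentzL_apply (X Y : Mink n) : lorentzL X Y = lorentz X Y := rfl

theorem lorentz_add_left (X Y V : Mink n) : lorentz (X + Y) V = lorentz X V + lorentz Y V := by
  simp only [← lorentzL_apply, map_add, _root_.add_apply]

theorem lorentz_sub_left (X Y V : Mink n) : lorentz (X - Y) V = lorentz X V - lorentz Y V := by
  simp only [← lorentzL_apply, map_sub, _root_.sub_apply]

theorem lorentz_smul_left (c : ℝ) (X V : Mink n) : lorentz (c • X) V = c * lorentz X V := by
  simp only [← lorentzL_apply, map_smul, _root_.smul_apply, smul_eq_mul]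

theorem hasFDerivAt_lorentz {F : Type*} [NormedAddCommGroup F] [NormedSpace ℝ F]
    {X Y : F → Mink n} {X' Y' : F →L[ℝ] Mink n} {x : F} (hX : HasFDerivAt X X' x)
    (hY : HasFDerivAt Y Y' x) :
    HasFDerivAt (fun y => lorentz (X y) (Y y)) (lorentzL (X x) ∘L Y' + lorentzL (Y x) ∘L X') x := by
  refine (lorentzL.hasFDerivAt_of_bilinear hX hY).congr_fderiv ?_
  ext v
  simp [lorentz_comm (X' v)]

theorem lorentz_add_lorentz_eq_zero_of_const {F : Type*} [NormedAddCommGroup F] [NormedSpace ℝ F]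
    {X Y : F → Mink n} {X' Y' : F →L[ℝ] Mink n} {x : F} {c : ℝ} (hX : HasFDerivAt X X' x)
    (hY : HasFDerivAt Y Y' x) (hXY : ∀ y, lorentz (X y) (Y y) = c) (v : F) :
    lorentz (X x) (Y' v) + lorentz (Y x) (X' v) = 0 := by
  have hderiv := hasFDerivAt_lorentz hX hY
  simp only [hXY] at hderiv
  exact DFunLike.congr_fun (hderiv.unique (hasFDerivAt_const c x)) v

theorem hasFDerivAt_z (X : Mink n) : HasFDerivAt z (lorentzL X) X := by
  have hsq := (hasFDerivAt_lorentz (hasFDerivAt_id X) (hasFDerivAt_id X)).mul_const (2⁻¹ : ℝ)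
  exact hsq.congr_fderiv (ContinuousLinearMap.ext fun v => by simp; ring)

section Graph

variable (u : EuclideanSpace ℝ (Fin n) → ℝ) (a : Mink n) (x : EuclideanSpace ℝ (Fin n))

/-- The derivative of the parametrization `x ↦ (x, u x)` of the graph of `u`, lifting vectors of
`ℝⁿ` to tangent vectors of the graph. -/
noncomputable def graphLift : EuclideanSpace ℝ (Fin n) →L[ℝ] Mink n :=
  (ContinuousLinearMap.id ℝ _).prod (fderiv ℝ u x)

/-- The future directed timelike unit normal of the graph of `u` at `(x, u x)`, which is
meaningful where `‖∇u‖ < 1`. -/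
noncomputable def graphNormal : Mink n :=
  (Real.sqrt (1 - ‖fderiv ℝ u x‖ ^ 2))⁻¹ • (gradient u x, 1)

/-- The induced metric of the graph of `u` in the coordinates `x ↦ (x, u x)`. -/
noncomputable def graphMetric : EuclideanSpace ℝ (Fin n) →L[ℝ] EuclideanSpace ℝ (Fin n) →L[ℝ] ℝ :=
  lorentzL.bilinearComp (graphLift u x) (graphLift u x)

/-- The second fundamental form `⟨∇̄_v ν, w⟩` of the graph of `u` in the coordinates
`x ↦ (x, u x)`. -/
noncomputable def secondFundForm :
    EuclideanSpace ℝ (Fin n) →L[ℝ] EuclideanSpace ℝ (Fin n) →L[ℝ] ℝ :=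
  lorentzL.bilinearComp (fderiv ℝ (graphNormal u) x) (graphLift u x)

/-- The Minkowski distance function `z (X - a)` from `a` at the point `X = (x, u x)`. -/
noncomputable def graphZ : ℝ := z ((x, u x) - a)

/-- The support function `⟨X - a, ν⟩` of the graph of `u` at the point `X = (x, u x)`. -/
noncomputable def supportFun : ℝ := lorentz ((x, u x) - a) (graphNormal u x)

/-- The gradient of `graphZ u a` for the metric `graphMetric u`, that is, the first component of
the tangential part of the position vector `X - a`. -/
noncomputable def graphGradient : EuclideanSpace ℝ (Fin n) :=
  (((x, u x) - a) + supportFun u a x • graphNormal u x).1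

variable {u a x} (v w : EuclideanSpace ℝ (Fin n))

theorem graphLift_apply : graphLift u x v = (v, fderiv ℝ u x v) := rfl

theorem graphMetric_apply :
    graphMetric u x v w = lorentz (graphLift u x v) (graphLift u x w) := rfl

theorem secondFundForm_apply : secondFundForm u x v w =
    lorentz (fderiv ℝ (graphNormal u) x v) (graphLift u x w) := rfl

theorem graphMetric_comm : graphMetric u x v w = graphMetric u x w v := lorentz_comm _ _

theorem lorentz_graphNormal (V : Mink n) : lorentz (graphNormal u x) V =
    (Real.sqrt (1 - ‖fderiv ℝ u x‖ ^ 2))⁻¹ * (fderiv ℝ u x V.1 - V.2) := by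
  rw [graphNormal, lorentz_smul_left, lorentz, inner_gradient_left, one_mul]

theorem lorentz_graphNormal_graphLift : lorentz (graphNormal u x) (graphLift u x v) = 0 := by
  simp [lorentz_graphNormal, graphLift_apply]

theorem graphLift_fst_of_hasDerivWithinAt {γ : ℝ → Mink n} {V : Mink n} {s : Set ℝ} {t : ℝ}
    (hs : UniqueDiffWithinAt ℝ s t) (hu : DifferentiableAt ℝ u (γ t).1)
    (hγ : HasDerivWithinAt γ V s t) (hγu : ∀ᶠ r in 𝓝[s] t, (γ r).2 = u (γ r).1)
    (ht : (γ t).2 = u (γ t).1) : graphLift u (γ t).1 V.1 = V := by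
  have hfst : HasDerivWithinAt (fun r => (γ r).1) V.1 s t :=
    (ContinuousLinearMap.fst ℝ (EuclideanSpace ℝ (Fin n)) ℝ).hasFDerivAt.comp_hasDerivWithinAt t hγ
  have hsnd : HasDerivWithinAt (fun r => (γ r).2) V.2 s t :=
    (ContinuousLinearMap.snd ℝ (EuclideanSpace ℝ (Fin n)) ℝ).hasFDerivAt.comp_hasDerivWithinAt t hγ
  have hu_comp : HasDerivWithinAt (fun r => u (γ r).1) (fderiv ℝ u (γ t).1 V.1) s t :=
    hu.hasFDerivAt.comp_hasDerivWithinAt t hfst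
  exact Prod.ext rfl (hs.eq_deriv _ hu_comp
    (hsnd.congr_of_eventuallyEq (hγu.mono fun _ => Eq.symm) ht.symm))

theorem two_mul_graphZ : 2 * graphZ u a x = ‖x - a.1‖ ^ 2 - |u x - a.2| ^ 2 := by
  simp only [graphZ, z, lorentz, Prod.fst_sub, Prod.snd_sub, real_inner_self_eq_norm_sq, sq_abs]
  ring

end Graph

namespace IsEntireGraphIn

variable {u : EuclideanSpace ℝ (Fin n) → ℝ} {a : Mink n} {x : EuclideanSpace ℝ (Fin n)}

theorem differentiable (hu : IsEntireGraphIn u M) : Differentiable ℝ u :=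
  hu.contDiff.differentiable two_ne_zero

theorem hasFDerivAt_graph (hu : IsEntireGraphIn u M) (x : EuclideanSpace ℝ (Fin n)) :
    HasFDerivAt (fun y => (y, u y)) (graphLift u x) x :=
  (hasFDerivAt_id x).prodMk (hu.differentiable x).hasFDerivAt

theorem isTangent_graphLift (hu : IsEntireGraphIn u M) (v : EuclideanSpace ℝ (Fin n)) :
    IsTangent M (x, u x) (graphLift u x v) :=
  isTangent_graph (.of_forall hu.mem) (hu.differentiable x) v

theorem graphLift_fst_of_isTangent (hu : IsEntireGraphIn u M) {V : Mink n}
    (hV : IsTangent M (x, u x) V) : graphLift u x V.1 = V := by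
  obtain ⟨γ, hγ0, hγM, hγ⟩ := hV
  have hlim : Tendsto γ (𝓝 0) (𝓝[M] (x, u x)) :=
    tendsto_nhdsWithin_iff.2 ⟨hγ0 ▸ hγ.continuousAt.tendsto, hγM⟩
  have hx : (γ 0).1 = x := by rw [hγ0]
  rw [← hx]
  exact graphLift_fst_of_hasDerivWithinAt uniqueDiffWithinAt_univ (hu.differentiable _)
    hγ.hasDerivWithinAt (by simpa using hlim.eventually (hu.eventually_eq x)) (by simp [hγ0])

theorem graphMetric_self_pos (hu : IsEntireGraphIn u M) {v : EuclideanSpace ℝ (Fin n)}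
    (hv : v ≠ 0) : 0 < graphMetric u x v v := by
  have hlt : ‖fderiv ℝ u x v‖ < ‖v‖ := ((fderiv ℝ u x).le_opNorm v).trans_lt
    (mul_lt_of_lt_one_left (norm_pos_iff.2 hv) (hu.norm_fderiv_lt_one x))
  have hsq := pow_lt_pow_left₀ hlt (norm_nonneg _) two_ne_zero
  rw [Real.norm_eq_abs, sq_abs, sq] at hsq
  simpa only [graphMetric_apply, graphLift_apply, lorentz, real_inner_self_eq_norm_sq, sub_pos]

theorem graphMetric_self_nonneg (hu : IsEntireGraphIn u M) (v : EuclideanSpace ℝ (Fin n)) :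
    0 ≤ graphMetric u x v v := by
  rcases eq_or_ne v 0 with rfl | hv
  exacts [by simp, (hu.graphMetric_self_pos hv).le]

theorem one_sub_sq_pos (hu : IsEntireGraphIn u M) (x : EuclideanSpace ℝ (Fin n)) :
    0 < 1 - ‖fderiv ℝ u x‖ ^ 2 :=
  sub_pos.2 (pow_lt_one₀ (norm_nonneg _) (hu.norm_fderiv_lt_one x) two_ne_zero)

theorem graphNormal_snd_pos (hu : IsEntireGraphIn u M) : 0 < (graphNormal u x).2 := by
  simpa [graphNormal] using hu.one_sub_sq_pos x

theorem lorentz_graphNormal_self (hu : IsEntireGraphIn u M) (x : EuclideanSpace ℝ (Fin n)) :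
    lorentz (graphNormal u x) (graphNormal u x) = -1 := by
  have hpos := hu.one_sub_sq_pos x
  have hgrad : fderiv ℝ u x (gradient u x) = ‖fderiv ℝ u x‖ ^ 2 := by
    rw [← inner_gradient_left, real_inner_self_eq_norm_sq, gradient, LinearIsometryEquiv.norm_map]
  have hinv : (Real.sqrt (1 - ‖fderiv ℝ u x‖ ^ 2))⁻¹ ^ 2 * (1 - ‖fderiv ℝ u x‖ ^ 2) = 1 := by
    rw [inv_pow, Real.sq_sqrt hpos.le, inv_mul_cancel₀ hpos.ne']
  rw [lorentz_graphNormal]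
  simp only [graphNormal, Prod.smul_fst, Prod.smul_snd, map_smul, hgrad, smul_eq_mul, mul_one]
  linear_combination -hinv

theorem isUnitNormal (hu : IsEntireGraphIn u M) (x : EuclideanSpace ℝ (Fin n)) :
    IsUnitNormal M (x, u x) (graphNormal u x) :=
  ⟨fun V hV => by rw [← hu.graphLift_fst_of_isTangent hV, lorentz_graphNormal_graphLift],
    hu.lorentz_graphNormal_self x, hu.graphNormal_snd_pos⟩

theorem graphLift_fst_of_lorentz_graphNormal_eq_zero (hu : IsEntireGraphIn u M) {V : Mink n}
    (hV : lorentz (graphNormal u x) V = 0) : graphLift u x V.1 = V := by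
  rw [lorentz_graphNormal, mul_eq_zero_iff_left
    (inv_ne_zero (Real.sqrt_pos.2 (hu.one_sub_sq_pos x)).ne'), sub_eq_zero] at hV
  exact Prod.ext rfl hV

theorem differentiable_fderiv (hu : IsEntireGraphIn u M) : Differentiable ℝ (fderiv ℝ u) :=
  (hu.contDiff.fderiv_right (m := 1) le_rfl).differentiable one_ne_zero

theorem differentiable_graphNormal (hu : IsEntireGraphIn u M) :
    Differentiable ℝ (graphNormal u) := fun x => by
  have hgrad := differentiableAt_gradient (hu.differentiable_fderiv x)
  have hnorm : DifferentiableAt ℝ (fun x => ‖fderiv ℝ u x‖ ^ 2) x := by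
    simpa [gradient] using hgrad.norm_sq ℝ
  have hsqrt := ((hnorm.const_sub 1).sqrt (hu.one_sub_sq_pos x).ne').inv
    (Real.sqrt_pos.2 (hu.one_sub_sq_pos x)).ne'
  exact hsqrt.smul (hgrad.prodMk (differentiableAt_const _))

theorem graphLift_fst_fderiv_graphNormal (hu : IsEntireGraphIn u M)
    (v : EuclideanSpace ℝ (Fin n)) :
    graphLift u x (fderiv ℝ (graphNormal u) x v).1 = fderiv ℝ (graphNormal u) x v := by
  have hν := (hu.differentiable_graphNormal x).hasFDerivAt
  refine hu.graphLift_fst_of_lorentz_graphNormal_eq_zero ?_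
  linarith [lorentz_add_lorentz_eq_zero_of_const hν hν hu.lorentz_graphNormal_self v]

theorem secondFundForm_eq (hu : IsEntireGraphIn u M) (v w : EuclideanSpace ℝ (Fin n)) :
    secondFundForm u x v w = (graphNormal u x).2 * fderiv ℝ (fderiv ℝ u) x v w := by
  have hlift : HasFDerivAt (fun y => graphLift u y w)
      ((0 : EuclideanSpace ℝ (Fin n) →L[ℝ] _).prod ((fderiv ℝ (fderiv ℝ u) x).flip w)) x :=
    (hasFDerivAt_const w x).prodMk <| by
      simpa using (hu.differentiable_fderiv x).hasFDerivAt.clm_apply (hasFDerivAt_const w x)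
  have hsum : lorentz (graphNormal u x) (0, fderiv ℝ (fderiv ℝ u) x v w) +
      lorentz (graphLift u x w) (fderiv ℝ (graphNormal u) x v) = 0 :=
    lorentz_add_lorentz_eq_zero_of_const (hu.differentiable_graphNormal x).hasFDerivAt hlift
      (fun y => lorentz_graphNormal_graphLift (x := y) w) v
  have hvert : lorentz (graphNormal u x) (0, fderiv ℝ (fderiv ℝ u) x v w) =
      -((graphNormal u x).2 * fderiv ℝ (fderiv ℝ u) x v w) := by
    simp [lorentz]
  rw [secondFundForm_apply, lorentz_comm]
  linarith

theorem secondFundForm_comm (hu : IsEntireGraphIn u M) (v w : EuclideanSpace ℝ (Fin n)) :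
    secondFundForm u x v w = secondFundForm u x w v := by
  have hsymm : IsSymmSndFDerivAt ℝ u x :=
    hu.contDiff.contDiffAt.isSymmSndFDerivAt (by simp)
  rw [hu.secondFundForm_eq, hu.secondFundForm_eq, hsymm.eq]

theorem fderiv_graphNormal_eq_smul (hu : IsEntireGraphIn u M) {v : EuclideanSpace ℝ (Fin n)}
    {κ : ℝ} (h : secondFundForm u x v = κ • graphMetric u x v) :
    fderiv ℝ (graphNormal u) x v = κ • graphLift u x v := by
  set d := (fderiv ℝ (graphNormal u) x v).1 - κ • v with hd
  have hlift : graphLift u x d = fderiv ℝ (graphNormal u) x v - κ • graphLift u x v := by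
    rw [hd, map_sub, map_smul, hu.graphLift_fst_fderiv_graphNormal]
  have hnull : graphMetric u x d d = 0 := by
    have hd_eq := DFunLike.congr_fun h d
    simp only [secondFundForm_apply, graphMetric_apply, _root_.smul_apply, smul_eq_mul] at hd_eq
    rw [graphMetric_apply]
    nth_rewrite 1 [hlift]
    rw [lorentz_sub_left, lorentz_smul_left, hd_eq, sub_self]
  have hd0 : d = 0 := by
    by_contra hne
    exact (hu.graphMetric_self_pos hne).ne' hnull
  rwa [hd0, map_zero, eq_comm, sub_eq_zero] at hlift

theorem isPrincipalCurvature (hu : IsEntireGraphIn u M) {v : EuclideanSpace ℝ (Fin n)} {κ : ℝ}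
    (hv : v ≠ 0) (h : secondFundForm u x v = κ • graphMetric u x v) :
    IsPrincipalCurvature M (x, u x) κ := by
  refine ⟨fun q => graphNormal u q.1, fderiv ℝ (graphNormal u) x ∘L .fst ℝ _ _, ?_, ?_,
    graphLift u x v, fun h0 => hv (congr_arg Prod.fst h0), hu.isTangent_graphLift v,
    hu.fderiv_graphNormal_eq_smul h⟩
  · filter_upwards [hu.eventually_eq x] with q hq
    rw [show q = (q.1, u q.1) from Prod.ext rfl hq]
    exact hu.isUnitNormal q.1
  · exact (HasFDerivAt.comp (f := Prod.fst) (x, u x)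
      (hu.differentiable_graphNormal x).hasFDerivAt hasFDerivAt_fst).hasFDerivWithinAt

theorem abs_secondFundForm_self_le (hu : IsEntireGraphIn u M) {C₀ : ℝ}
    (hC : PrincipalCurvaturesBoundedBy M C₀) (v : EuclideanSpace ℝ (Fin n)) :
    |secondFundForm u x v v| ≤ C₀ * graphMetric u x v v :=
  abs_apply_self_le_of_forall_eigenvector graphMetric_comm (fun _ => hu.graphMetric_self_pos)
    hu.secondFundForm_comm (fun κ _ hv h => hC _ (hu.mem x) κ (hu.isPrincipalCurvature hv h)) v

theorem abs_sub_lt (hu : IsEntireGraphIn u M) {x y : EuclideanSpace ℝ (Fin n)} (hxy : x ≠ y) :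
    |u x - u y| < ‖x - y‖ :=
  abs_sub_lt_norm_sub_of_norm_fderiv_lt_one hu.differentiable hu.norm_fderiv_lt_one hxy

theorem graphZ_nonneg (hu : IsEntireGraphIn u M) (ha : u a.1 = a.2)
    (x : EuclideanSpace ℝ (Fin n)) : 0 ≤ graphZ u a x := by
  rcases eq_or_ne x a.1 with rfl | hx
  · simp [graphZ, z, lorentz, ha]
  · have hlt := pow_lt_pow_left₀ (hu.abs_sub_lt hx) (abs_nonneg _) two_ne_zero
    rw [ha] at hlt
    linarith [two_mul_graphZ (u := u) (a := a) (x := x)]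

theorem hasFDerivAt_graphZ (hu : IsEntireGraphIn u M) (a : Mink n) (x : EuclideanSpace ℝ (Fin n)) :
    HasFDerivAt (graphZ u a) (lorentzL ((x, u x) - a) ∘L graphLift u x) x :=
  (hasFDerivAt_z _).comp x ((hu.hasFDerivAt_graph x).sub_const a)

theorem differentiable_graphZ (hu : IsEntireGraphIn u M) : Differentiable ℝ (graphZ u a) :=
  fun x => (hu.hasFDerivAt_graphZ a x).differentiableAt

theorem isCompact_sublevel_graphZ (hu : IsEntireGraphIn u M) (ha : u a.1 = a.2) (c : ℝ) :
    IsCompact {x | graphZ u a x ≤ c} := by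
  obtain ⟨δ, hδ, hle⟩ := exists_pos_abs_sub_le_norm_sub (fun _ _ => hu.abs_sub_lt) a.1
  refine isCompact_of_isClosed_isBounded
    (isClosed_le hu.differentiable_graphZ.continuous continuous_const)
    ((isBounded_closedBall (x := a.1) (r := max 1 (2 * c / δ))).subset fun x hx =>
      mem_closedBall_iff_norm.2 ?_)
  refine (le_or_gt ‖x - a.1‖ 1).elim le_max_of_le_left fun hfar => le_max_of_le_right ?_
  have hx : graphZ u a x ≤ c := hx
  have hgap := hle x hfar.le
  rw [ha] at hgap
  rw [le_div_iff₀ hδ]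
  calc ‖x - a.1‖ * δ
    _ ≤ (‖x - a.1‖ + |u x - a.2|) * (‖x - a.1‖ - |u x - a.2|) := by
      have := abs_nonneg (u x - a.2)
      gcongr <;> linarith
    _ = 2 * graphZ u a x := by rw [two_mul_graphZ]; ring
    _ ≤ 2 * c := by linarith

theorem graphLift_graphGradient (hu : IsEntireGraphIn u M) (a : Mink n)
    (x : EuclideanSpace ℝ (Fin n)) : graphLift u x (graphGradient u a x) =
      ((x, u x) - a) + supportFun u a x • graphNormal u x := by
  refine hu.graphLift_fst_of_lorentz_graphNormal_eq_zero ?_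
  rw [lorentz_comm, lorentz_add_left, lorentz_smul_left, hu.lorentz_graphNormal_self, supportFun]
  ring

theorem graphMetric_graphGradient (hu : IsEntireGraphIn u M) (a : Mink n)
    (x v : EuclideanSpace ℝ (Fin n)) :
    graphMetric u x (graphGradient u a x) v = lorentz ((x, u x) - a) (graphLift u x v) := by
  rw [graphMetric_apply, hu.graphLift_graphGradient, lorentz_add_left, lorentz_smul_left,
    lorentz_graphNormal_graphLift, mul_zero, add_zero]

theorem fderiv_graphZ (hu : IsEntireGraphIn u M) (v : EuclideanSpace ℝ (Fin n)) :
    fderiv ℝ (graphZ u a) x v = graphMetric u x (graphGradient u a x) v := by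
  rw [(hu.hasFDerivAt_graphZ a x).fderiv, hu.graphMetric_graphGradient]
  rfl

theorem hasFDerivAt_supportFun (hu : IsEntireGraphIn u M) (a : Mink n)
    (x : EuclideanSpace ℝ (Fin n)) :
    HasFDerivAt (supportFun u a) (lorentzL ((x, u x) - a) ∘L fderiv ℝ (graphNormal u) x +
      lorentzL (graphNormal u x) ∘L graphLift u x) x :=
  hasFDerivAt_lorentz ((hu.hasFDerivAt_graph x).sub_const a)
    (hu.differentiable_graphNormal x).hasFDerivAt

theorem fderiv_supportFun (hu : IsEntireGraphIn u M) (v : EuclideanSpace ℝ (Fin n)) :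
    fderiv ℝ (supportFun u a) x v = secondFundForm u x v (graphGradient u a x) := by
  rw [(hu.hasFDerivAt_supportFun a x).fderiv, secondFundForm_apply, lorentz_comm,
    ← hu.graphLift_fst_fderiv_graphNormal v, ← graphMetric_apply, hu.graphMetric_graphGradient]
  simp only [_root_.add_apply, ContinuousLinearMap.comp_apply, lorentzL_apply,
    lorentz_graphNormal_graphLift, add_zero, hu.graphLift_fst_fderiv_graphNormal]

theorem graphMetric_graphGradient_self (hu : IsEntireGraphIn u M) (a : Mink n)
    (x : EuclideanSpace ℝ (Fin n)) :
    graphMetric u x (graphGradient u a x) (graphGradient u a x) =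
      2 * graphZ u a x + supportFun u a x ^ 2 := by
  rw [hu.graphMetric_graphGradient, hu.graphLift_graphGradient, lorentz_comm, lorentz_add_left,
    lorentz_smul_left, lorentz_comm (graphNormal u x), graphZ, z, supportFun]
  ring

theorem mul_supportFun_le (hu : IsEntireGraphIn u M) {C₀ : ℝ}
    (hC : PrincipalCurvaturesBoundedBy M C₀) (ha : u a.1 = a.2) {σ : ℝ} (hσ : |σ| ≤ 1)
    (x : EuclideanSpace ℝ (Fin n)) : σ * supportFun u a x ≤ (C₀ + 1) * graphZ u a x := by
  have hs : Differentiable ℝ (supportFun u a) :=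
    fun x => (hu.hasFDerivAt_supportFun a x).differentiableAt
  have hz : Differentiable ℝ (graphZ u a) := hu.differentiable_graphZ
  rw [← sub_nonpos]
  refine nonpos_of_isCompact_sublevel (f := fun x => σ * supportFun u a x - (C₀ + 1) * graphZ u a x)
    hz ((hs.const_mul σ).sub (hz.const_mul _)) (hu.isCompact_sublevel_graphZ ha) (fun x hx => ?_) x
  have hg : 0 < graphMetric u x (graphGradient u a x) (graphGradient u a x) := by
    rw [hu.graphMetric_graphGradient_self]
    by_contra! hle
    have hZ : graphZ u a x = 0 := by
      linarith [hu.graphZ_nonneg ha x, sq_nonneg (supportFun u a x)]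
    have hS : supportFun u a x = 0 := by
      rw [hZ, mul_zero, zero_add] at hle
      exact pow_eq_zero_iff two_ne_zero |>.1 (le_antisymm hle (sq_nonneg _))
    simp [hZ, hS] at hx
  refine ⟨-graphGradient u a x, ?_, ?_⟩
  · rwa [map_neg, hu.fderiv_graphZ, neg_lt_zero]
  · have hII : σ * secondFundForm u x (graphGradient u a x) (graphGradient u a x) ≤
        C₀ * graphMetric u x (graphGradient u a x) (graphGradient u a x) :=
      calc _ ≤ |σ| * |secondFundForm u x (graphGradient u a x) (graphGradient u a x)| :=
            (le_abs_self _).trans_eq (abs_mul _ _)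
        _ ≤ _ := (mul_le_of_le_one_left (abs_nonneg _) hσ).trans
            (hu.abs_secondFundForm_self_le hC _)
    rw [fderiv_fun_sub ((hs x).const_mul σ) ((hz x).const_mul _), fderiv_const_mul (hs x),
      fderiv_const_mul (hz x)]
    simp only [_root_.sub_apply, _root_.smul_apply, smul_eq_mul, map_neg, hu.fderiv_graphZ,
      hu.fderiv_supportFun]
    linarith

theorem graphMetric_graphGradient_self_le (hu : IsEntireGraphIn u M) {C₀ : ℝ}
    (hC : PrincipalCurvaturesBoundedBy M C₀) (ha : u a.1 = a.2) (x : EuclideanSpace ℝ (Fin n)) :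
    graphMetric u x (graphGradient u a x) (graphGradient u a x) ≤
      (1 + (C₀ + 1) ^ 2) * (graphZ u a x + 1) ^ 2 := by
  have hs : |supportFun u a x| ≤ (C₀ + 1) * graphZ u a x := abs_le'.2
    ⟨by simpa using hu.mul_supportFun_le hC ha (σ := 1) (by simp) x,
      by simpa using hu.mul_supportFun_le hC ha (σ := -1) (by simp) x⟩
  have hz := hu.graphZ_nonneg ha x
  calc graphMetric u x (graphGradient u a x) (graphGradient u a x)
    _ = 2 * graphZ u a x + |supportFun u a x| ^ 2 := by
      rw [hu.graphMetric_graphGradient_self, sq_abs]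
    _ ≤ 2 * graphZ u a x + ((C₀ + 1) * graphZ u a x) ^ 2 := by gcongr
    _ ≤ (1 + (C₀ + 1) ^ 2) * (graphZ u a x + 1) ^ 2 := by
      nlinarith [mul_nonneg (sq_nonneg (C₀ + 1)) hz, sq_nonneg (graphZ u a x)]

theorem isInducedGradient_z (hu : IsEntireGraphIn u M) (x : EuclideanSpace ℝ (Fin n)) :
    IsInducedGradient M z (x, u x) (graphLift u x (graphGradient u 0 x)) := by
  refine ⟨hu.isTangent_graphLift _, fun V hV => ?_⟩
  rw [← hu.graphLift_fst_of_isTangent hV, ← graphMetric_apply, hu.graphMetric_graphGradient,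
    sub_zero, (hasFDerivAt_z _).fderiv, lorentzL_apply]

end IsEntireGraphIn

theorem IsSpacelikeHypersurface.exists_isInducedGradient_le (hM : IsSpacelikeHypersurface M)
    (hMc : IsClosed M) (hconn : IsConnected M) (h0 : (0 : Mink n) ∈ M) {C₀ : ℝ}
    (hC : PrincipalCurvaturesBoundedBy M C₀) {X : Mink n} (hX : X ∈ M) :
    ∃ G, IsInducedGradient M z X G ∧ lorentz G G ≤ (1 + (C₀ + 1) ^ 2) * (z X + 1) ^ 2 := by
  obtain ⟨u, hu0, hu⟩ := hM.exists_isEntireGraphIn hMc h0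
  obtain ⟨x, y⟩ := X
  obtain rfl : y = u x :=
    hu.snd_eq_of_isPreconnected hconn.isPreconnected subset_rfl h0 hu0.symm hX
  refine ⟨_, hu.isInducedGradient_z x, ?_⟩
  rw [← graphMetric_apply]
  simpa [graphZ] using hu.graphMetric_graphGradient_self_le hC hu0 x

/-! ### Completeness -/

/-- A `C¹` curve `[0, 1] → M`, as used to define the induced distance. The values of `γ` outside
`[0, 1]` are irrelevant. -/
structure IsC1CurveIn (M : Set (Mink n)) (γ : ℝ → Mink n) : Prop where
  contDiffOn : ContDiffOn ℝ 1 γ (Icc 0 1)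
  mapsTo : MapsTo γ (Icc 0 1) M

theorem inducedEDist_le_inducedLength {γ : ℝ → Mink n} (hγ : IsC1CurveIn M γ) {p q : Mink n}
    (h0 : γ 0 = p) (h1 : γ 1 = q) : inducedEDist M p q ≤ inducedLength γ :=
  iInf₂_le γ ⟨hγ.contDiffOn, hγ.mapsTo, h0, h1⟩

theorem inducedEDist_lt_iff {p q : Mink n} {L : ℝ≥0∞} : inducedEDist M p q < L ↔
    ∃ γ, IsC1CurveIn M γ ∧ γ 0 = p ∧ γ 1 = q ∧ inducedLength γ < L := by
  simp only [inducedEDist, iInf_lt_iff]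
  exact ⟨fun ⟨γ, ⟨hγ, hγM, h0, h1⟩, hL⟩ => ⟨γ, ⟨hγ, hγM⟩, h0, h1, hL⟩,
    fun ⟨γ, hγ, h0, h1, hL⟩ => ⟨γ, ⟨hγ.contDiffOn, hγ.mapsTo, h0, h1⟩, hL⟩⟩

namespace IsEntireGraphIn

variable {u : EuclideanSpace ℝ (Fin n) → ℝ} {a : Mink n} {x : EuclideanSpace ℝ (Fin n)}
  {γ : ℝ → Mink n} {t : ℝ}

theorem snd_eq_of_isC1CurveIn (hu : IsEntireGraphIn u M) (hγ : IsC1CurveIn M γ)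
    (hγ0 : (γ 0).2 = u (γ 0).1) (ht : t ∈ Icc (0 : ℝ) 1) : (γ t).2 = u (γ t).1 :=
  hu.snd_eq_of_isPreconnected (isPreconnected_Icc.image γ hγ.contDiffOn.continuousOn)
    hγ.mapsTo.image_subset (mem_image_of_mem γ (left_mem_Icc.2 zero_le_one)) hγ0
    (mem_image_of_mem γ ht)

theorem graphLift_fst_derivWithin (hu : IsEntireGraphIn u M) (hγ : IsC1CurveIn M γ)
    (hγ0 : (γ 0).2 = u (γ 0).1) (ht : t ∈ Icc (0 : ℝ) 1) :
    graphLift u (γ t).1 (derivWithin γ (Icc 0 1) t).1 = derivWithin γ (Icc 0 1) t :=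
  graphLift_fst_of_hasDerivWithinAt (uniqueDiffOn_Icc zero_lt_one t ht) (hu.differentiable _)
    (hγ.contDiffOn.differentiableOn one_ne_zero t ht).hasDerivWithinAt
    (eventually_mem_nhdsWithin.mono fun _ => hu.snd_eq_of_isC1CurveIn hγ hγ0)
    (hu.snd_eq_of_isC1CurveIn hγ hγ0 ht)

theorem enorm_comp_fst_sub_le (hu : IsEntireGraphIn u M) (hγ : IsC1CurveIn M γ)
    (hγ0 : (γ 0).2 = u (γ 0).1) {F : Type*} [NormedAddCommGroup F] [NormedSpace ℝ F]
    {f : EuclideanSpace ℝ (Fin n) → F} (hf : ContDiff ℝ 1 f) {B : ℝ}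
    (hB : ∀ t ∈ Icc (0 : ℝ) 1, ∀ v,
      ‖fderiv ℝ f (γ t).1 v‖ ≤ B * Real.sqrt (graphMetric u (γ t).1 v v))
    (ht : t ∈ Icc (0 : ℝ) 1) :
    ‖f (γ t).1 - f (γ 0).1‖ₑ ≤ ENNReal.ofReal B * inducedLength γ := by
  have hderiv : ∀ r ∈ Icc (0 : ℝ) 1, derivWithin (f ∘ fun r => (γ r).1) (Icc 0 1) r =
      fderiv ℝ f (γ r).1 (derivWithin γ (Icc 0 1) r).1 := fun r hr =>
    ((hf.differentiable one_ne_zero _).hasFDerivAt.comp_hasDerivWithinAt r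
      ((ContinuousLinearMap.fst ℝ (EuclideanSpace ℝ (Fin n)) ℝ).hasFDerivAt.comp_hasDerivWithinAt r
        (hγ.contDiffOn.differentiableOn one_ne_zero r hr).hasDerivWithinAt)).derivWithin
      (uniqueDiffOn_Icc zero_lt_one r hr)
  refine (enorm_sub_le_lintegral_derivWithin_of_mem_Icc
    (hf.comp_contDiffOn hγ.contDiffOn.fst) ht).trans ?_
  rw [inducedLength, ← lintegral_const_mul' _ _ ENNReal.ofReal_ne_top]
  refine setLIntegral_mono' measurableSet_Icc fun r hr => ?_
  rw [hderiv r hr, ← ofReal_norm, ← ENNReal.ofReal_mul' (Real.sqrt_nonneg _),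
    ← hu.graphLift_fst_derivWithin hγ hγ0 hr]
  exact ENNReal.ofReal_le_ofReal (hB r hr _)

theorem contDiff_graph (hu : IsEntireGraphIn u M) : ContDiff ℝ 1 fun x => (x, u x) :=
  contDiff_id.prodMk (hu.contDiff.of_le one_le_two)

theorem inducedEDist_graph_le (hu : IsEntireGraphIn u M) (x y : EuclideanSpace ℝ (Fin n)) :
    inducedEDist M (x, u x) (y, u y) ≤ edist x y := by
  have hcurve : IsC1CurveIn M ((fun x => (x, u x)) ∘ AffineMap.lineMap x y) :=
    ⟨(hu.contDiff_graph.comp (AffineMap.contDiff_lineMap x y)).contDiffOn, fun _ _ => hu.mem _⟩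
  refine (inducedEDist_le_inducedLength hcurve (by simp) (by simp)).trans ?_
  calc inducedLength _
    _ ≤ ∫⁻ _ in Icc (0 : ℝ) 1, edist x y := setLIntegral_mono' measurableSet_Icc fun t ht => ?_
    _ = edist x y := by simp
  rw [((hu.hasFDerivAt_graph _).comp_hasDerivWithinAt t
    AffineMap.hasDerivWithinAt_lineMap).derivWithin (uniqueDiffOn_Icc zero_lt_one t ht),
    edist_dist, dist_eq_norm_sub']
  refine ENNReal.ofReal_le_ofReal (Real.sqrt_le_iff.2 ⟨norm_nonneg _, ?_⟩)
  simp only [lorentz, graphLift_apply, real_inner_self_eq_norm_sq]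
  linarith [mul_self_nonneg (fderiv ℝ u (AffineMap.lineMap x y t) (y - x))]

theorem graphZ_add_one_pos (hu : IsEntireGraphIn u M) (ha : u a.1 = a.2)
    (x : EuclideanSpace ℝ (Fin n)) : 0 < graphZ u a x + 1 :=
  add_pos_of_nonneg_of_pos (hu.graphZ_nonneg ha x) one_pos

theorem abs_fderiv_log_graphZ_le (hu : IsEntireGraphIn u M) {C₀ : ℝ}
    (hC : PrincipalCurvaturesBoundedBy M C₀) (ha : u a.1 = a.2)
    (x v : EuclideanSpace ℝ (Fin n)) :
    |fderiv ℝ (fun x => Real.log (graphZ u a x + 1)) x v| ≤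
      Real.sqrt (1 + (C₀ + 1) ^ 2) * Real.sqrt (graphMetric u x v v) := by
  have hpos := hu.graphZ_add_one_pos ha x
  have hCS := sq_apply_le_of_symm (graphMetric u x) graphMetric_comm hu.graphMetric_self_nonneg
    (graphGradient u a x) v
  rw [fderiv.log ((hu.differentiable_graphZ x).add_const 1) hpos.ne', fderiv_add_const,
    _root_.smul_apply, hu.fderiv_graphZ, smul_eq_mul, inv_mul_eq_div,
    ← Real.sqrt_mul (by positivity)]
  refine Real.abs_le_sqrt ?_
  rw [div_pow, div_le_iff₀ (by positivity), mul_right_comm]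
  exact hCS.trans (mul_le_mul_of_nonneg_right (hu.graphMetric_graphGradient_self_le hC ha x)
    (hu.graphMetric_self_nonneg v))

theorem contDiff_graphZ (hu : IsEntireGraphIn u M) : ContDiff ℝ 1 (graphZ u a) := by
  have hX : ContDiff ℝ 1 fun x => ((x, u x) - a : Mink n) := hu.contDiff_graph.sub contDiff_const
  exact ((lorentzL.contDiff.comp hX).clm_apply hX).div_const 2

theorem graphZ_add_one_le_of_inducedLength_le_one (hu : IsEntireGraphIn u M) {C₀ : ℝ}
    (hC : PrincipalCurvaturesBoundedBy M C₀) (ha : u a.1 = a.2) (hγ : IsC1CurveIn M γ)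
    (hγ0 : (γ 0).2 = u (γ 0).1) (hlen : inducedLength γ ≤ 1) (ht : t ∈ Icc (0 : ℝ) 1) :
    graphZ u a (γ t).1 + 1 ≤
      Real.exp (Real.sqrt (1 + (C₀ + 1) ^ 2)) * (graphZ u a (γ 0).1 + 1) := by
  have hlip := (hu.enorm_comp_fst_sub_le hγ hγ0
    ((hu.contDiff_graphZ.add contDiff_const).log fun x => (hu.graphZ_add_one_pos ha x).ne')
    (fun t _ v => hu.abs_fderiv_log_graphZ_le hC ha _ v) ht).trans (mul_le_of_le_one_right' hlen)
  rw [← ofReal_norm, ENNReal.ofReal_le_ofReal_iff (Real.sqrt_nonneg _), Real.norm_eq_abs] at hlip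
  rw [← Real.log_le_log_iff (hu.graphZ_add_one_pos ha _)
    (mul_pos (Real.exp_pos _) (hu.graphZ_add_one_pos ha _)),
    Real.log_mul (Real.exp_pos _).ne' (hu.graphZ_add_one_pos ha _).ne', Real.log_exp]
  linarith [le_abs_self
    (Real.log (graphZ u a (γ t).1 + 1) - Real.log (graphZ u a (γ 0).1 + 1))]

theorem exists_norm_le_mul_sqrt_graphMetric (hu : IsEntireGraphIn u M)
    {K : Set (EuclideanSpace ℝ (Fin n))} (hK : IsCompact K) :
    ∃ D > 0, ∀ x ∈ K, ∀ v, ‖v‖ ≤ D * Real.sqrt (graphMetric u x v v) := by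
  rcases K.eq_empty_or_nonempty with rfl | hne
  · exact ⟨1, one_pos, by simp⟩
  obtain ⟨y, -, hy⟩ := hK.exists_isMaxOn hne (f := fun x => ‖fderiv ℝ u x‖)
    hu.differentiable_fderiv.continuous.norm.continuousOn
  have hpos := hu.one_sub_sq_pos y
  refine ⟨(Real.sqrt (1 - ‖fderiv ℝ u y‖ ^ 2))⁻¹, by positivity, fun x hx v => ?_⟩
  have hdu : |fderiv ℝ u x v| ≤ ‖fderiv ℝ u y‖ * ‖v‖ := (fderiv ℝ u x).le_of_opNorm_le (hy hx) v
  rw [inv_mul_eq_div, le_div_iff₀ (Real.sqrt_pos.2 hpos)]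
  refine Real.le_sqrt_of_sq_le ?_
  calc (‖v‖ * Real.sqrt (1 - ‖fderiv ℝ u y‖ ^ 2)) ^ 2
    _ = ‖v‖ ^ 2 - (‖fderiv ℝ u y‖ * ‖v‖) ^ 2 := by rw [mul_pow, Real.sq_sqrt hpos.le]; ring
    _ ≤ ‖v‖ ^ 2 - |fderiv ℝ u x v| ^ 2 := by gcongr
    _ = graphMetric u x v v := by
      rw [graphMetric_apply, graphLift_apply, lorentz, real_inner_self_eq_norm_sq, sq_abs, ← sq]

theorem exists_edist_lt_mul_of_inducedEDist_lt (hu : IsEntireGraphIn u M) {C₀ : ℝ}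
    (hC : PrincipalCurvaturesBoundedBy M C₀) (ha : u a.1 = a.2) (c : ℝ) :
    ∃ D : ℝ, 0 < D ∧ ∀ x, graphZ u a x ≤ c → ∀ (q : Mink n) (L : ℝ≥0∞), L ≤ 1 →
      inducedEDist M (x, u x) q < L → edist x q.1 < ENNReal.ofReal D * L := by
  set R := Real.exp (Real.sqrt (1 + (C₀ + 1) ^ 2)) * (c + 1) with hR
  obtain ⟨D, hD, hDK⟩ := hu.exists_norm_le_mul_sqrt_graphMetric
    (hu.isCompact_sublevel_graphZ ha R)
  refine ⟨D, hD, fun x hx q L hL hq => ?_⟩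
  obtain ⟨γ, hγ, hγ0, rfl, hlen⟩ := inducedEDist_lt_iff.1 hq
  have hγu : (γ 0).2 = u (γ 0).1 := by rw [hγ0]
  have hmem : ∀ t ∈ Icc (0 : ℝ) 1, graphZ u a (γ t).1 ≤ R := fun t ht => by
    have hgrowth := hu.graphZ_add_one_le_of_inducedLength_le_one hC ha hγ hγu (hlen.le.trans hL) ht
    have hmono : Real.exp (Real.sqrt (1 + (C₀ + 1) ^ 2)) * (graphZ u a (γ 0).1 + 1) ≤ R := by
      rw [hγ0, hR]
      gcongr
    linarith
  calc edist x (γ 1).1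
    _ = ‖(γ 1).1 - (γ 0).1‖ₑ := by rw [edist_comm, edist_eq_enorm_sub, hγ0]
    _ ≤ ENNReal.ofReal D * inducedLength γ := hu.enorm_comp_fst_sub_le hγ hγu contDiff_id
      (fun t ht v => by simpa using hDK _ (hmem t ht) v) (right_mem_Icc.2 zero_le_one)
    _ < ENNReal.ofReal D * L := ENNReal.mul_lt_mul_right (by simpa using hD)
      ENNReal.ofReal_ne_top hlen

theorem snd_eq_and_graphZ_le_of_inducedEDist_lt_one (hu : IsEntireGraphIn u M) {C₀ : ℝ}
    (hC : PrincipalCurvaturesBoundedBy M C₀) (ha : u a.1 = a.2) {q : Mink n}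
    (hq : inducedEDist M a q < 1) :
    q.2 = u q.1 ∧ graphZ u a q.1 ≤ Real.exp (Real.sqrt (1 + (C₀ + 1) ^ 2)) := by
  obtain ⟨γ, hγ, rfl, rfl, hlen⟩ := inducedEDist_lt_iff.1 hq
  have h1 : (1 : ℝ) ∈ Icc (0 : ℝ) 1 := right_mem_Icc.2 zero_le_one
  refine ⟨hu.snd_eq_of_isC1CurveIn hγ ha.symm h1, ?_⟩
  have hgrowth := hu.graphZ_add_one_le_of_inducedLength_le_one hC ha hγ ha.symm hlen.le h1
  have hstart : graphZ u (γ 0) (γ 0).1 = 0 := by simp [graphZ, z, lorentz, ha]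
  rw [hstart, zero_add, mul_one] at hgrowth
  linarith

end IsEntireGraphIn

theorem IsSpacelikeHypersurface.isInducedComplete (hM : IsSpacelikeHypersurface M)
    (hMc : IsClosed M) {C₀ : ℝ} (hC : PrincipalCurvaturesBoundedBy M C₀) :
    IsInducedComplete M := by
  intro x hx hcau
  obtain ⟨N, hN⟩ := hcau 1 one_pos
  obtain ⟨u, ha, hu⟩ := hM.exists_isEntireGraphIn hMc (hx N)
  have htail := fun k (hk : k ≥ N) =>
    hu.snd_eq_and_graphZ_le_of_inducedEDist_lt_one hC ha (hN N le_rfl k hk)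
  obtain ⟨D, hD, hdist⟩ := hu.exists_edist_lt_mul_of_inducedEDist_lt hC ha
    (Real.exp (Real.sqrt (1 + (C₀ + 1) ^ 2)))
  have hgraph : ∀ k ≥ N, ((x k).1, u (x k).1) = x k := fun k hk =>
    Prod.ext rfl (htail k hk).1.symm
  have hfst : CauchySeq fun k => (x k).1 := by
    refine EMetric.cauchySeq_iff.2 fun ε hε => ?_
    have hD0 : ENNReal.ofReal D ≠ 0 := by simpa using hD
    obtain ⟨N', hN'⟩ := hcau (min 1 (ε / ENNReal.ofReal D))
      (lt_min one_pos (ENNReal.div_pos hε.ne' ENNReal.ofReal_ne_top))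
    refine ⟨max N N', fun k hk l hl => ?_⟩
    have hkN := (le_max_left _ _).trans hk
    calc edist (x k).1 (x l).1
      _ < ENNReal.ofReal D * min 1 (ε / ENNReal.ofReal D) := by
        refine hdist _ (htail k hkN).2 _ _ (min_le_left _ _) ?_
        rw [hgraph k hkN]
        exact hN' k ((le_max_right _ _).trans hk) l ((le_max_right _ _).trans hl)
      _ ≤ ENNReal.ofReal D * (ε / ENNReal.ofReal D) := by gcongr; exact min_le_right _ _
      _ = ε := ENNReal.mul_div_cancel hD0 ENNReal.ofReal_ne_top
  obtain ⟨y, hy⟩ := cauchySeq_tendsto_of_complete hfst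
  refine ⟨(y, u y), hu.mem y, tendsto_of_tendsto_of_tendsto_of_le_of_le' tendsto_const_nhds
    (tendsto_iff_edist_tendsto_0.1 hy) (.of_forall fun _ => zero_le) ?_⟩
  filter_upwards [eventually_ge_atTop N] with k hk
  rw [← hgraph k hk]
  exact hu.inducedEDist_graph_le _ _

end Mink

theorem proposition6p1 :
    (∀ C₀ : ℝ, ∃ C : ℝ, ∀ (n : ℕ) (M : Set (Mink n)), 1 ≤ n →
      Mink.IsSpacelikeHypersurface M → IsClosed M → IsConnected M → (0 : Mink n) ∈ M →
      Mink.PrincipalCurvaturesBoundedBy M C₀ →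
      ∀ X ∈ M, ∃ G : Mink n, Mink.IsInducedGradient M Mink.z X G ∧
        Mink.lorentz G G ≤ C * (Mink.z X + 1) ^ 2) ∧
    (∀ (n : ℕ) (M : Set (Mink n)), 1 ≤ n →
      Mink.IsSpacelikeHypersurface M → IsClosed M →
      (∃ C₀ : ℝ, Mink.PrincipalCurvaturesBoundedBy M C₀) →
      Mink.IsInducedComplete M) := by
  refine ⟨fun C₀ => ⟨1 + (C₀ + 1) ^ 2, fun n M _ hM hMc hconn h0 hC X hX => ?_⟩, ?_⟩
  · exact hM.exists_isInducedGradient_le hMc hconn h0 hC hX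
  · rintro n M - hM hMc ⟨C₀, hC⟩
    exact hM.isInducedComplete hMc hC
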